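/- **Theorem 2.** Let $\mathcal S$ and $\mathcal A$ be finite sets of states and actions, let $r:\mathcal S\times\mathcal A\to[0,1]$ be a reward function, and let $\mathcal P=\bigotimes_{s,a}\mathcal P_s^a$ be an $(s,a)$-rectangular uncertainty set whose components $\mathcal P_s^a$ are non-empty compact subsets of the probability simplex $\Delta(\mathcal S)$. Assume that the model is unichain: for every kernel $\mathsf P=\{p_s^a\}\in\mathcal P$ and every stationary (randomized) policy $\pi:\mathcal S\to\Delta(\mathcal A)$, the Markov chain on $\mathcal S$ with transition matrix $\mathsf P^\pi_{s,s'}=\sum_a\pi(a|s)\,p^a_{s,s'}$ has a single recurrent class (and possibly transient states). For a sequence of kernels $\kappa=(\mathsf P_0,\mathsf P_1,\dots)\in\bigotimes_{t\ge0}\mathcal P$ and a stationary policy $\pi$, let $\mathbb E_{\pi,\kappa}[\,\cdot\mid S_0=s]$ denote the expectation for the process $(s_t,a_t)_{t\ge0}$ with $s_0=s$, $a_t\sim\pi(\cdot|s_t)$ and $s_{t+1}$ drawn from the component of $\mathsf P_t$ at $(s_t,a_t)$, and put $r_t=r(s_t,a_t)$. Define, for $\gamma\in[0,1)$, $$V^\pi_{\mathcal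 P,\gamma}(s)=\min_{\kappa\in\bigotimes_{t\ge0}\mathcal P}\mathbb E_{\pi,\kappa}\Big[\sum_{t=0}^\infty\gamma^t r_t\,\Big|\,S_0=s\Big],\qquad g^\pi_{\mathcal P}(s)=\min_{\kappa\in\bigotimes_{t\ge0}\mathcal P}\ \liminf_{n\to\infty}\mathbb E_{\pi,\kappa}\Big[\frac1n\sum_{t=0}^{n-1}r_t\,\Big|\,S_0=s\Big].$$ Then both minima exist, the second one is attained at a $\kappa$ for which the $\liminf$ is a limit, and $$\lim_{\gamma\to1^-}(1-\gamma)V^\pi_{\mathcal P,\gamma}(s)=g^\pi_{\mathcal P}(s)$$ uniformly over all stationary policies $\pi$ and all $s\in\mathcal S$. -/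

import Mathlib

open Filter Topology MeasureTheory ProbabilityTheory

noncomputable section

namespace RobustMDP

variable {S A : Type*} [Fintype S] [Fintype A]

/-- A stationary (randomized) policy: for every state `s`, a distribution `π(· | s)` on actions. -/
abbrev Policy (S A : Type*) [Fintype A] : Type _ := S → stdSimplex ℝ A

/-- A transition kernel `P = {p_s^a}`: for every state-action pair, a distribution on states. -/
abbrev TransitionKernel (S A : Type*) [Fintype S] : Type _ := S → A → stdSimplex ℝ S

/-- The `(s,a)`-rectangular uncertainty set `⨂_{s,a} 𝒫_s^a` with components `𝒫_s^a ⊆ Δ(S)`. -/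
def rectSet (U : S → A → Set (stdSimplex ℝ S)) : Set (TransitionKernel S A) :=
  {P | ∀ s a, P s a ∈ U s a}

/-- The time-varying models `κ = (P₀, P₁, …) ∈ ⨂_{t ≥ 0} 𝒫`. -/
def kernelSeqs (U : S → A → Set (stdSimplex ℝ S)) : Set (ℕ → TransitionKernel S A) :=
  {κ | ∀ t, κ t ∈ rectSet U}

/-! ### Unichain transition matrices -/

/-- The state transition matrix induced by a policy and a kernel,
`(P^π)_{s,s'} = ∑ a, π(a|s) p^a_{s,s'}`. -/
def inducedMatrix (π : Policy S A) (P : TransitionKernel S A) : Matrix S S ℝ :=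
  Matrix.of fun s s' => ∑ a, π s a * P s a s'

/-- `s'` is accessible from `s`: there is a finite path (possibly of length `0`) from `s` to `s'`
all of whose steps have positive probability. -/
def Accessible (Q : Matrix S S ℝ) : S → S → Prop :=
  Relation.ReflTransGen fun s s' => 0 < Q s s'

/-- Recurrence of a state of a finite Markov chain: it can be reached back from every state that is
accessible from it. -/
def IsRecurrentState (Q : Matrix S S ℝ) (s : S) : Prop :=
  ∀ s', Accessible Q s s' → Accessible Q s' s

/-- A finite Markov chain is a unichain if it has a single recurrent class (together with a possibly
empty set of transient states): any two recurrent states communicate. A recurrent state always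
exists as soon as there is a state. Periodic chains are allowed. -/
def IsUnichain (Q : Matrix S S ℝ) : Prop :=
  ∀ s s', IsRecurrentState Q s → IsRecurrentState Q s' → Accessible Q s s'

/-! ### The law of the state-action process -/

/-- The measure on a finite type given by a probability vector. -/
def toMeasure {X : Type*} [Fintype X] [MeasurableSpace X] (p : stdSimplex ℝ X) : Measure X :=
  ∑ x, ENNReal.ofReal (p x) • Measure.dirac x

instance {X : Type*} [Fintype X] [MeasurableSpace X] (p : stdSimplex ℝ X) :
    IsProbabilityMeasure (toMeasure p) := by
  constructor
  have h0 : ∀ x ∈ Finset.univ, 0 ≤ p x := fun x _ => p.2.1 x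
  have h1 : ∑ x, p x = 1 := p.2.2
  simp [toMeasure, ← ENNReal.ofReal_sum_of_nonneg h0, h1]

variable [MeasurableSpace S] [MeasurableSpace A]
  [MeasurableSingletonClass S] [MeasurableSingletonClass A]

/-- In state `s`, draw an action `a` from `π(· | s)`; record the pair `(s, a)`. -/
def actionLaw (π : Policy S A) (s : S) : Measure (S × A) :=
  (toMeasure (π s)).map (Prod.mk s)

instance (π : Policy S A) (s : S) : IsProbabilityMeasure (actionLaw π s) :=
  Measure.isProbabilityMeasure_map (measurable_of_finite _).aemeasurable

/-- One transition under the kernel `P`: from the state-action pair `(s, a)`, draw the next state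
`s'` from `p_s^a`, then draw the next action from `π(· | s')`. -/
def stepKernel (π : Policy S A) (P : TransitionKernel S A) : Kernel (S × A) (S × A) where
  toFun x := (toMeasure (P x.1 x.2)).bind (actionLaw π)
  measurable' := measurable_of_finite _

instance (π : Policy S A) (P : TransitionKernel S A) : IsMarkovKernel (stepKernel π P) := by
  constructor
  intro x
  change IsProbabilityMeasure ((toMeasure (P x.1 x.2)).bind (actionLaw π))
  refine ⟨?_⟩
  rw [Measure.bind_apply MeasurableSet.univ (measurable_of_finite _).aemeasurable]
  simp

/-- The kernel for step `t`, as a function of the whole history up to time `t`: it only uses the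
current pair `(s_t, a_t)` and the kernel `κ t`. -/
def historyKernel (π : Policy S A) (κ : ℕ → TransitionKernel S A) (t : ℕ) :
    Kernel ((_i : Finset.Iic t) → S × A) (S × A) :=
  (stepKernel π (κ t)).comap (fun h => h ⟨t, Finset.mem_Iic.2 le_rfl⟩) (measurable_pi_apply _)

instance (π : Policy S A) (κ : ℕ → TransitionKernel S A) (t : ℕ) :
    IsMarkovKernel (historyKernel π κ t) := by
  unfold historyKernel; infer_instance

/-- The law on infinite trajectories `(s_t, a_t)_{t ≥ 0}` of the process started from `S₀ = s`, with
actions drawn from the policy `π` and the transition at time `t` drawn from the kernel `κ t`. -/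
def pathLaw (π : Policy S A) (κ : ℕ → TransitionKernel S A) (s : S) : Measure (ℕ → S × A) :=
  Kernel.trajMeasure (X := fun _ => S × A) (actionLaw π s) (historyKernel π κ)

instance (π : Policy S A) (κ : ℕ → TransitionKernel S A) (s : S) :
    IsProbabilityMeasure (pathLaw π κ s) := by
  unfold pathLaw; infer_instance

/-! ### Value functions -/

/-- `E_{π,κ}[∑_{t ≥ 0} γ^t r(s_t,a_t) | S₀ = s]`. -/
def discountedValue (r : S → A → ℝ) (γ : ℝ) (π : Policy S A) (κ : ℕ → TransitionKernel S A)
    (s : S) : ℝ :=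
  ∫ ω, ∑' t : ℕ, γ ^ t * r (ω t).1 (ω t).2 ∂(pathLaw π κ s)

/-- `E_{π,κ}[(1/n) ∑_{t < n} r(s_t,a_t) | S₀ = s]`. -/
def finiteAverage (r : S → A → ℝ) (π : Policy S A) (κ : ℕ → TransitionKernel S A)
    (s : S) (n : ℕ) : ℝ :=
  ∫ ω, (1 / (n : ℝ)) * ∑ t ∈ Finset.range n, r (ω t).1 (ω t).2 ∂(pathLaw π κ s)

/-- The long-run average reward of a time-varying model, `lim_n E_{π,κ}[(1/n) ∑_{t < n} r_t | S₀ = s]`.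
For some sequences `κ` this limit does not exist; the limit inferior, which equals the limit
whenever it exists, gives every `κ` a value. -/
def averageReward (r : S → A → ℝ) (π : Policy S A) (κ : ℕ → TransitionKernel S A) (s : S) : ℝ :=
  liminf (finiteAverage r π κ s) atTop

/-- The robust discounted value function `V^π_{𝒫,γ}(s)`: the worst case over time-varying models. -/
def robustDiscountedValue (r : S → A → ℝ) (U : S → A → Set (stdSimplex ℝ S)) (γ : ℝ)
    (π : Policy S A) (s : S) : ℝ :=
  sInf ((fun κ => discountedValue r γ π κ s) '' kernelSeqs U)

/-- The robust average reward `g^π_𝒫(s)`: the worst case over time-varying models. -/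
def robustAverageReward (r : S → A → ℝ) (U : S → A → Set (stdSimplex ℝ S))
    (π : Policy S A) (s : S) : ℝ :=
  sInf ((fun κ => averageReward r π κ s) '' kernelSeqs U)

end RobustMDP

end

noncomputable section
namespace RobustMDP

/-! Fix a policy. For `γ < 1` the robust Bellman operator is a contraction. At its fixed point `V`,
rectangularity lets one kernel `P` attain every inner minimum at once
(`exists_discounted_optimality`). Telescoping the Bellman inequality along any time-varying model
shows that `V` is the robust value and that the constant model `P` attains it
(`isLeast_discountedValue`).

The unichain assumption enters through `exists_oscillation_bound`: the oscillation of `V` is at most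
some `C` independent of `γ`, the policy and the kernel. Otherwise rescaled value functions would
approach a nonconstant harmonic function of a unichain matrix; compactness makes this quantitative
(`exists_pos_le_sum_abs_sub`).

With `h = V - V s`, the Bellman equation reads `(1 - γ) V s + h = r + γ P h`, averaged over actions.
Telescoping it undiscounted costs at most `(1 - γ) C` per step, so the robust average reward at `s`
differs from `(1 - γ) V s` by at most `(1 - γ) C`, which is uniform. Attainment of the average
minimum comes from the same equation at `γ = 1`, obtained as a limit by compactness
(`exists_average_optimality`). -/

/-! ### Means with respect to a probability vector -/

section Mean

variable {X : Type*} [Fintype X]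

/-- The mean of `f` with respect to the probability vector `p`. -/
def mean (p : stdSimplex ℝ X) (f : X → ℝ) : ℝ := ∑ x, p x * f x

lemma mean_mono (p : stdSimplex ℝ X) {f g : X → ℝ} (h : ∀ x, f x ≤ g x) : mean p f ≤ mean p g :=
  Finset.sum_le_sum fun x _ => mul_le_mul_of_nonneg_left (h x) (stdSimplex.zero_le p x)

lemma mean_const (p : stdSimplex ℝ X) (c : ℝ) : mean p (fun _ => c) = c := by
  rw [mean, ← Finset.sum_mul, stdSimplex.sum_eq_one, one_mul]

lemma mean_add (p : stdSimplex ℝ X) (f g : X → ℝ) :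
    mean p (fun x => f x + g x) = mean p f + mean p g := by
  simp only [mean, mul_add, Finset.sum_add_distrib]

lemma mean_sub (p : stdSimplex ℝ X) (f g : X → ℝ) :
    mean p (fun x => f x - g x) = mean p f - mean p g := by
  simp only [mean, mul_sub, Finset.sum_sub_distrib]

lemma mean_const_mul (p : stdSimplex ℝ X) (c : ℝ) (f : X → ℝ) :
    mean p (fun x => c * f x) = c * mean p f := by
  simp only [mean, Finset.mul_sum]
  exact Finset.sum_congr rfl fun x _ => by ring

lemma mean_le (p : stdSimplex ℝ X) {f : X → ℝ} {c : ℝ} (h : ∀ x, f x ≤ c) : mean p f ≤ c :=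
  (mean_mono p h).trans_eq (mean_const p c)

lemma le_mean (p : stdSimplex ℝ X) {f : X → ℝ} {c : ℝ} (h : ∀ x, c ≤ f x) : c ≤ mean p f :=
  (mean_const p c).symm.trans_le (mean_mono p h)

lemma abs_mean_le (p : stdSimplex ℝ X) {f : X → ℝ} {c : ℝ} (h : ∀ x, |f x| ≤ c) :
    |mean p f| ≤ c :=
  abs_le.2 ⟨le_mean p fun x => (abs_le.1 (h x)).1, mean_le p fun x => (abs_le.1 (h x)).2⟩

lemma exists_abs_le (f : X → ℝ) : ∃ C, ∀ x, |f x| ≤ C :=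
  ⟨∑ x, |f x|, fun x =>
    Finset.single_le_sum (f := fun x => |f x|) (fun _ _ => abs_nonneg _) (Finset.mem_univ x)⟩

lemma continuous_mean : Continuous fun z : stdSimplex ℝ X × (X → ℝ) => mean z.1 z.2 := by
  refine continuous_finsetSum _ fun x _ => ?_
  refine Continuous.mul ?_ ((continuous_apply x).comp continuous_snd)
  exact (continuous_apply x).comp (continuous_subtype_val.comp continuous_fst)

lemma integral_toMeasure [MeasurableSpace X] [MeasurableSingletonClass X]
    (p : stdSimplex ℝ X) (f : X → ℝ) : ∫ x, f x ∂toMeasure p = mean p f := by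
  rw [toMeasure, integral_finsetSum_measure]
  · refine Finset.sum_congr rfl fun x _ => ?_
    rw [integral_smul_measure, integral_dirac, ENNReal.toReal_ofReal (stdSimplex.zero_le p x),
      smul_eq_mul]
  · intro x _
    exact Integrable.of_finite.smul_measure ENNReal.ofReal_ne_top

end Mean

/-! ### Bellman operators -/

section Bellman

variable {S A : Type*} [Fintype S] [Fintype A]

/-- The mean of `h` after one step of the chain with policy `π` and kernel `P`. -/
def stepMean (π : Policy S A) (P : TransitionKernel S A) (h : S → ℝ) (s : S) : ℝ :=
  mean (π s) fun a => mean (P s a) h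

/-- The right-hand side of the Bellman equation for a policy and a kernel. -/
def bellman (r : S → A → ℝ) (γ : ℝ) (π : Policy S A) (P : TransitionKernel S A) (h : S → ℝ)
    (s : S) : ℝ :=
  mean (π s) fun a => r s a + γ * mean (P s a) h

lemma bellman_eq (r : S → A → ℝ) (γ : ℝ) (π : Policy S A) (P : TransitionKernel S A)
    (h : S → ℝ) (s : S) :
    bellman r γ π P h s = mean (π s) (r s) + γ * stepMean π P h s := by
  rw [bellman, mean_add, mean_const_mul]
  rfl

lemma bellman_mono {r : S → A → ℝ} {γ : ℝ} (hγ : 0 ≤ γ) (π : Policy S A)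
    {P Q : TransitionKernel S A} {h : S → ℝ} (H : ∀ s a, mean (P s a) h ≤ mean (Q s a) h)
    (s : S) : bellman r γ π P h s ≤ bellman r γ π Q h s :=
  mean_mono _ fun a => by gcongr; exact H s a

lemma stepMean_sub_const (π : Policy S A) (P : TransitionKernel S A) (h : S → ℝ) (c : ℝ)
    (s : S) : stepMean π P (fun s' => h s' - c) s = stepMean π P h s - c := by
  simp only [stepMean, mean_sub, mean_const]

lemma stepMean_const_mul (π : Policy S A) (P : TransitionKernel S A) (h : S → ℝ) (c : ℝ)
    (s : S) : stepMean π P (fun s' => c * h s') s = c * stepMean π P h s := by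
  simp only [stepMean, mean_const_mul]

lemma stepMean_le (π : Policy S A) (P : TransitionKernel S A) {h : S → ℝ} {c : ℝ}
    (hc : ∀ s, h s ≤ c) (s : S) : stepMean π P h s ≤ c :=
  mean_le _ fun _ => mean_le _ hc

lemma le_stepMean (π : Policy S A) (P : TransitionKernel S A) {h : S → ℝ} {c : ℝ}
    (hc : ∀ s, c ≤ h s) (s : S) : c ≤ stepMean π P h s :=
  le_mean _ fun _ => le_mean _ hc

lemma continuous_stepMean (s : S) : Continuous
    fun z : Policy S A × TransitionKernel S A × (S → ℝ) => stepMean z.1 z.2.1 z.2.2 s := by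
  refine continuous_mean.comp (Continuous.prodMk ?_ (continuous_pi fun a => ?_))
  · exact (continuous_apply s).comp continuous_fst
  · refine continuous_mean.comp (Continuous.prodMk ?_ ?_)
    · exact (continuous_apply a).comp ((continuous_apply s).comp
        (continuous_fst.comp continuous_snd))
    · exact continuous_snd.comp continuous_snd

end Bellman

/-! ### One-time marginals of the state-action process -/

section Law

variable {S A : Type*} [Fintype S] [Fintype A] [MeasurableSpace S] [MeasurableSpace A]
  [MeasurableSingletonClass S] [MeasurableSingletonClass A]

lemma integral_actionLaw (π : Policy S A) (s : S) (f : S × A → ℝ) :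
    ∫ x, f x ∂actionLaw π s = mean (π s) fun a => f (s, a) := by
  rw [actionLaw, integral_map (measurable_of_finite _).aemeasurable
    (measurable_of_finite f).aestronglyMeasurable, integral_toMeasure]

lemma integral_stepKernel (π : Policy S A) (P : TransitionKernel S A) (x : S × A)
    (f : S × A → ℝ) :
    ∫ y, f y ∂stepKernel π P x =
      mean (P x.1 x.2) fun s' => mean (π s') fun a => f (s', a) := by
  let η : Kernel S (S × A) := ⟨actionLaw π, measurable_of_finite _⟩
  change ∫ y, f y ∂(η ∘ₘ toMeasure (P x.1 x.2)) = _
  have : IsMarkovKernel η := ⟨fun s => inferInstanceAs (IsProbabilityMeasure (actionLaw π s))⟩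
  rw [Measure.comp_eq_comp_const_apply, Kernel.integral_comp Integrable.of_finite,
    Kernel.const_apply, integral_toMeasure]
  exact congrArg _ (funext fun s' => integral_actionLaw π s' f)

/-- The expectation of a function of the state-action pair visited at time `t`. -/
def pairExpectation (π : Policy S A) (κ : ℕ → TransitionKernel S A) (s : S) (t : ℕ)
    (f : S × A → ℝ) : ℝ :=
  ∫ ω, f (ω t) ∂pathLaw π κ s

lemma map_zero_pathLaw (π : Policy S A) (κ : ℕ → TransitionKernel S A) (s : S) :
    (pathLaw π κ s).map (fun ω => ω 0) = actionLaw π s := by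
  have h : (fun ω : ℕ → S × A => ω 0) =
    (fun x : (_i : Finset.Iic 0) → S × A => x ⟨0, Finset.mem_Iic.2 le_rfl⟩) ∘
      Preorder.frestrictLe (π := fun _ => S × A) 0 := rfl
  rw [h, ← Measure.map_map (measurable_pi_apply _) (by fun_prop), pathLaw, Kernel.trajMeasure,
    Measure.map_comp _ _ (by fun_prop), Kernel.traj_map_frestrictLe, Kernel.partialTraj_self,
    Measure.id_comp, Measure.map_map (measurable_pi_apply _) (by fun_prop)]
  exact Measure.map_id

lemma pairExpectation_zero (π : Policy S A) (κ : ℕ → TransitionKernel S A) (s : S)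
    (f : S × A → ℝ) : pairExpectation π κ s 0 f = mean (π s) fun a => f (s, a) := by
  rw [← integral_actionLaw, ← map_zero_pathLaw π κ s, integral_map
    (measurable_pi_apply _).aemeasurable (measurable_of_finite f).aestronglyMeasurable]
  rfl

/-- This is the Markov property: the joint law of the history up to `t` and the next pair
disintegrates through `historyKernel`, which sees only the last pair. -/
lemma pairExpectation_succ (π : Policy S A) (κ : ℕ → TransitionKernel S A) (s : S) (t : ℕ)
    (f : S × A → ℝ) : pairExpectation π κ s (t + 1) f =
      pairExpectation π κ s t fun x =>
        mean (κ t x.1 x.2) fun s' => mean (π s') fun a => f (s', a) := by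
  have key := Kernel.map_frestrictLe_trajMeasure_compProd_eq_map_trajMeasure (X := fun _ => S × A)
    (μ₀ := actionLaw π s) (κ := historyKernel π κ) (a := t)
  rw [← pathLaw] at key
  have hf : StronglyMeasurable (fun z : ((_i : Finset.Iic t) → S × A) × (S × A) => f z.2) :=
    ((measurable_of_finite f).comp measurable_snd).stronglyMeasurable
  have h1 : pairExpectation π κ s (t + 1) f = ∫ z, f z.2 ∂((pathLaw π κ s).map
      (fun x ↦ (Preorder.frestrictLe (π := fun _ => S × A) t x, x (t + 1)))) := by
    have hφ : Measurable (fun x : ℕ → S × A =>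
      (Preorder.frestrictLe (π := fun _ => S × A) t x, x (t + 1))) := by fun_prop
    rw [integral_map hφ.aemeasurable hf.aestronglyMeasurable]
    rfl
  have : IsProbabilityMeasure
      ((pathLaw π κ s).map (Preorder.frestrictLe (π := fun _ => S × A) t)) :=
    Measure.isProbabilityMeasure_map (by fun_prop)
  have hint : Integrable (fun z : ((_i : Finset.Iic t) → S × A) × (S × A) => f z.2)
      (((pathLaw π κ s).map (Preorder.frestrictLe (π := fun _ => S × A) t)) ⊗ₘ
        historyKernel π κ t) :=
    (Integrable.of_finite (f := f)).comp_measurable measurable_snd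
  rw [h1, ← key, Measure.integral_compProd hint, integral_map (by fun_prop)]
  · refine integral_congr_ae (ae_of_all _ fun ω => ?_)
    exact integral_stepKernel π (κ t) (ω t) f
  · simp only [historyKernel, Kernel.comap_apply, integral_stepKernel]
    exact ((measurable_of_finite fun x : S × A =>
      mean (κ t x.1 x.2) fun s' => mean (π s') fun a => f (s', a)).comp
        (measurable_pi_apply _)).aestronglyMeasurable

lemma integrable_pair (π : Policy S A) (κ : ℕ → TransitionKernel S A) (s : S) (t : ℕ)
    (f : S × A → ℝ) : Integrable (fun ω => f (ω t)) (pathLaw π κ s) := by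
  have h : Measurable fun ω : ℕ → S × A => ω t := measurable_pi_apply t
  have : IsProbabilityMeasure ((pathLaw π κ s).map fun ω => ω t) :=
    Measure.isProbabilityMeasure_map h.aemeasurable
  exact (Integrable.of_finite (f := f)).comp_measurable h

lemma pairExpectation_mono (π : Policy S A) (κ : ℕ → TransitionKernel S A) (s : S) (t : ℕ)
    {f g : S × A → ℝ} (h : ∀ x, f x ≤ g x) :
    pairExpectation π κ s t f ≤ pairExpectation π κ s t g :=
  integral_mono (integrable_pair π κ s t f) (integrable_pair π κ s t g) fun ω => h (ω t)

lemma pairExpectation_const (π : Policy S A) (κ : ℕ → TransitionKernel S A) (s : S) (t : ℕ)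
    (c : ℝ) : pairExpectation π κ s t (fun _ => c) = c := by
  simp [pairExpectation]

lemma pairExpectation_add (π : Policy S A) (κ : ℕ → TransitionKernel S A) (s : S) (t : ℕ)
    (f g : S × A → ℝ) : pairExpectation π κ s t (fun x => f x + g x) =
      pairExpectation π κ s t f + pairExpectation π κ s t g :=
  integral_add (integrable_pair π κ s t f) (integrable_pair π κ s t g)

lemma pairExpectation_const_mul (π : Policy S A) (κ : ℕ → TransitionKernel S A) (s : S) (t : ℕ)
    (c : ℝ) (f : S × A → ℝ) : pairExpectation π κ s t (fun x => c * f x) =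
      c * pairExpectation π κ s t f :=
  integral_const_mul c _

lemma abs_pairExpectation_le (π : Policy S A) (κ : ℕ → TransitionKernel S A) (s : S) (t : ℕ)
    {f : S × A → ℝ} {c : ℝ} (h : ∀ x, |f x| ≤ c) : |pairExpectation π κ s t f| ≤ c := by
  rw [abs_le]
  exact ⟨(pairExpectation_const π κ s t (-c)).symm.trans_le
      (pairExpectation_mono π κ s t fun x => (abs_le.1 (h x)).1),
    (pairExpectation_mono π κ s t fun x => (abs_le.1 (h x)).2).trans_eq
      (pairExpectation_const π κ s t c)⟩

/-- Given the state at time `t`, the action is drawn from the policy. -/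
lemma pairExpectation_mean_action (π : Policy S A) (κ : ℕ → TransitionKernel S A) (s : S) (t : ℕ)
    (f : S × A → ℝ) : pairExpectation π κ s t (fun x => mean (π x.1) fun a => f (x.1, a)) =
      pairExpectation π κ s t f := by
  cases t with
  | zero => simp only [pairExpectation_zero, mean_const]
  | succ t => simp only [pairExpectation_succ, mean_const]

/-- The expected reward at time `t`. -/
def expectedReward (r : S → A → ℝ) (π : Policy S A) (κ : ℕ → TransitionKernel S A) (s : S)
    (t : ℕ) : ℝ :=
  pairExpectation π κ s t fun x => r x.1 x.2

/-- The expectation of a function of the state at time `t`. -/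
def stateExpectation (π : Policy S A) (κ : ℕ → TransitionKernel S A) (s : S) (h : S → ℝ)
    (t : ℕ) : ℝ :=
  pairExpectation π κ s t fun x => h x.1

lemma stateExpectation_zero (π : Policy S A) (κ : ℕ → TransitionKernel S A) (s : S)
    (h : S → ℝ) : stateExpectation π κ s h 0 = h s := by
  rw [stateExpectation, pairExpectation_zero]
  exact mean_const (π s) (h s)

lemma abs_stateExpectation_le (π : Policy S A) (κ : ℕ → TransitionKernel S A) (s : S)
    {h : S → ℝ} {C : ℝ} (hC : ∀ s, |h s| ≤ C) (t : ℕ) : |stateExpectation π κ s h t| ≤ C :=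
  abs_pairExpectation_le π κ s t fun x => hC x.1

/-- Turns pointwise Bellman relations into scalar recursions in `t`, to which the telescoping
estimates apply. -/
lemma stateExpectation_bellman (r : S → A → ℝ) (γ : ℝ) (π : Policy S A)
    (κ : ℕ → TransitionKernel S A) (s : S) (h : S → ℝ) (t : ℕ) :
    stateExpectation π κ s (bellman r γ π (κ t) h) t =
      expectedReward r π κ s t + γ * stateExpectation π κ s h (t + 1) := by
  rw [stateExpectation, expectedReward, stateExpectation, pairExpectation_succ]
  simp only [mean_const]
  rw [← pairExpectation_const_mul, ← pairExpectation_add]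
  exact pairExpectation_mean_action π κ s t fun x => r x.1 x.2 + γ * mean (κ t x.1 x.2) h

lemma add_stateExpectation_le (r : S → A → ℝ) {γ c : ℝ} {π : Policy S A}
    {κ : ℕ → TransitionKernel S A} {h : S → ℝ} {t : ℕ}
    (H : ∀ s, c + h s ≤ bellman r γ π (κ t) h s) (s : S) :
    c + stateExpectation π κ s h t ≤
      expectedReward r π κ s t + γ * stateExpectation π κ s h (t + 1) := by
  rw [← stateExpectation_bellman, ← pairExpectation_const π κ s t c, stateExpectation,
    ← pairExpectation_add]
  exact pairExpectation_mono π κ s t fun x => H x.1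

lemma add_stateExpectation_eq (r : S → A → ℝ) {γ c : ℝ} {π : Policy S A}
    {κ : ℕ → TransitionKernel S A} {h : S → ℝ} {t : ℕ}
    (H : ∀ s, c + h s = bellman r γ π (κ t) h s) (s : S) :
    c + stateExpectation π κ s h t =
      expectedReward r π κ s t + γ * stateExpectation π κ s h (t + 1) := by
  rw [← stateExpectation_bellman, ← pairExpectation_const π κ s t c, stateExpectation,
    ← pairExpectation_add]
  exact congrArg _ (funext fun x => H x.1)

lemma finiteAverage_eq (r : S → A → ℝ) (π : Policy S A) (κ : ℕ → TransitionKernel S A) (s : S)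
    (n : ℕ) : finiteAverage r π κ s n =
      1 / (n : ℝ) * ∑ t ∈ Finset.range n, expectedReward r π κ s t := by
  rw [finiteAverage, integral_const_mul, integral_finsetSum]
  · rfl
  · exact fun t _ => integrable_pair π κ s t fun x => r x.1 x.2

lemma abs_expectedReward_le {r : S → A → ℝ} (hr : ∀ s a, r s a ∈ Set.Icc (0 : ℝ) 1)
    (π : Policy S A) (κ : ℕ → TransitionKernel S A) (s : S) (t : ℕ) :
    |expectedReward r π κ s t| ≤ 1 :=
  abs_pairExpectation_le π κ s t fun x =>
    abs_le.2 ⟨by linarith [(hr x.1 x.2).1], (hr x.1 x.2).2⟩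

/-- Dominated convergence with the geometric bound `γ ^ t` exchanges expectation and series. -/
lemma hasSum_discountedValue {r : S → A → ℝ} (hr : ∀ s a, r s a ∈ Set.Icc (0 : ℝ) 1) {γ : ℝ}
    (hγ : γ ∈ Set.Ico (0 : ℝ) 1) (π : Policy S A) (κ : ℕ → TransitionKernel S A) (s : S) :
    HasSum (fun t => γ ^ t * expectedReward r π κ s t) (discountedValue r γ π κ s) := by
  have hbd : ∀ (t : ℕ) (ω : ℕ → S × A), ‖γ ^ t * r (ω t).1 (ω t).2‖ ≤ γ ^ t := fun t ω => by
    have h0 := pow_nonneg hγ.1 t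
    rw [norm_mul, Real.norm_of_nonneg h0, Real.norm_of_nonneg (hr _ _).1]
    exact mul_le_of_le_one_right h0 (hr _ _).2
  have hsum := summable_geometric_of_lt_one hγ.1 hγ.2
  have := hasSum_integral_of_dominated_convergence (μ := pathLaw π κ s)
    (F := fun t ω => γ ^ t * r (ω t).1 (ω t).2)
    (f := fun ω => ∑' t : ℕ, γ ^ t * r (ω t).1 (ω t).2)
    (fun t _ => γ ^ t)
    (fun t => ((integrable_pair π κ s t fun x => r x.1 x.2).const_mul (γ ^ t)).1)
    (fun t => ae_of_all _ (hbd t)) (ae_of_all _ fun _ => hsum) (integrable_const _)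
    (ae_of_all _ fun ω => (hsum.of_norm_bounded fun t => hbd t ω).hasSum)
  simp only [integral_const_mul] at this
  exact this

lemma abs_finiteAverage_le {r : S → A → ℝ} (hr : ∀ s a, r s a ∈ Set.Icc (0 : ℝ) 1)
    (π : Policy S A) (κ : ℕ → TransitionKernel S A) (s : S) (n : ℕ) :
    |finiteAverage r π κ s n| ≤ 1 := by
  rw [finiteAverage_eq, abs_mul, abs_of_nonneg (by positivity : (0 : ℝ) ≤ 1 / n), one_div]
  calc (n : ℝ)⁻¹ * |∑ t ∈ Finset.range n, expectedReward r π κ s t|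
      ≤ (n : ℝ)⁻¹ * n := by
        gcongr
        refine (Finset.abs_sum_le_sum_abs _ _).trans ?_
        refine (Finset.sum_le_sum fun t _ => abs_expectedReward_le hr π κ s t).trans ?_
        simp
    _ ≤ 1 := inv_mul_le_one

lemma le_averageReward {r : S → A → ℝ} (hr : ∀ s a, r s a ∈ Set.Icc (0 : ℝ) 1)
    {π : Policy S A} {κ : ℕ → TransitionKernel S A} {s : S} {l : ℕ → ℝ} {c : ℝ}
    (hl : Tendsto l atTop (𝓝 c)) (h : ∀ᶠ n in atTop, l n ≤ finiteAverage r π κ s n) :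
    c ≤ averageReward r π κ s := by
  rw [← hl.liminf_eq]
  refine liminf_le_liminf h hl.isBoundedUnder_ge ?_
  exact (isBoundedUnder_of ⟨1, fun n => (abs_le.1 (abs_finiteAverage_le hr π κ s n)).2⟩ :
    IsBoundedUnder (· ≤ ·) atTop _).isCoboundedUnder_ge

lemma averageReward_le {r : S → A → ℝ} (hr : ∀ s a, r s a ∈ Set.Icc (0 : ℝ) 1)
    {π : Policy S A} {κ : ℕ → TransitionKernel S A} {s : S} {l : ℕ → ℝ} {c : ℝ}
    (hl : Tendsto l atTop (𝓝 c)) (h : ∀ᶠ n in atTop, finiteAverage r π κ s n ≤ l n) :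
    averageReward r π κ s ≤ c := by
  rw [← hl.liminf_eq]
  refine liminf_le_liminf h ?_ hl.isBoundedUnder_le.isCoboundedUnder_ge
  exact isBoundedUnder_of ⟨-1, fun n => (abs_le.1 (abs_finiteAverage_le hr π κ s n)).1⟩

end Law

/-! ### Telescoping estimates -/

section Telescoping

variable {ρ η : ℕ → ℝ} {C c γ : ℝ}

/-- Iterating `n` times leaves the remainder `γ ^ n * η n`, which vanishes because `η` is bounded.
-/
lemma le_of_hasSum_of_le_add_mul {D : ℝ} (hγ : γ ∈ Set.Ico (0 : ℝ) 1) (hη : ∀ t, |η t| ≤ C)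
    (h : ∀ t, η t ≤ ρ t + γ * η (t + 1)) (hD : HasSum (fun t => γ ^ t * ρ t) D) : η 0 ≤ D := by
  have hpart : ∀ n, η 0 ≤ ∑ t ∈ Finset.range n, γ ^ t * ρ t + γ ^ n * η n := by
    intro n
    induction n with
    | zero => simp
    | succ n ih =>
      rw [Finset.sum_range_succ, pow_succ]
      nlinarith [mul_le_mul_of_nonneg_left (h n) (pow_nonneg hγ.1 n)]
  have hpart' : ∀ n, η 0 ≤ ∑ t ∈ Finset.range n, γ ^ t * ρ t + γ ^ n * C := fun n =>
    (hpart n).trans (add_le_add le_rfl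
      (mul_le_mul_of_nonneg_left (abs_le.1 (hη n)).2 (pow_nonneg hγ.1 n)))
  have hlim : Tendsto (fun n => ∑ t ∈ Finset.range n, γ ^ t * ρ t + γ ^ n * C) atTop
      (𝓝 (D + 0 * C)) :=
    hD.tendsto_sum_nat.add ((tendsto_pow_atTop_nhds_zero_of_lt_one hγ.1 hγ.2).mul_const C)
  rw [zero_mul, add_zero] at hlim
  exact ge_of_tendsto' hlim hpart'

/-- The sum telescopes, and the two boundary terms contribute at most `2 * C`. -/
lemma sub_div_le_average (hη : ∀ t, |η t| ≤ C) (h : ∀ t, c + η t ≤ ρ t + η (t + 1)) {n : ℕ}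
    (hn : 0 < n) : c - 2 * C / n ≤ 1 / (n : ℝ) * ∑ t ∈ Finset.range n, ρ t := by
  have hpart : n * c + η 0 ≤ ∑ t ∈ Finset.range n, ρ t + η n := by
    clear hn
    induction n with
    | zero => simp
    | succ n ih =>
      rw [Finset.sum_range_succ]
      push_cast
      linarith [h n]
  have hn' : (0 : ℝ) < n := Nat.cast_pos.2 hn
  have h0 := abs_le.1 (hη 0)
  have h1 := abs_le.1 (hη n)
  rw [one_div, inv_mul_eq_div, le_div_iff₀ hn', sub_mul, div_mul_cancel₀ _ hn'.ne']
  linarith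

lemma average_le_add_div (hη : ∀ t, |η t| ≤ C) (h : ∀ t, ρ t + η (t + 1) ≤ c + η t) {n : ℕ}
    (hn : 0 < n) : 1 / (n : ℝ) * ∑ t ∈ Finset.range n, ρ t ≤ c + 2 * C / n := by
  have := sub_div_le_average (ρ := fun t => -ρ t) (η := fun t => -η t) (c := -c) (C := C)
    (fun t => by rw [abs_neg]; exact hη t) (fun t => by linarith [h t]) hn
  rw [Finset.sum_neg_distrib, mul_neg] at this
  linarith

lemma tendsto_add_const_div (c C : ℝ) : Tendsto (fun n : ℕ => c + C / n) atTop (𝓝 c) := by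
  simpa using tendsto_const_nhds.add (tendsto_const_div_atTop_nhds_zero_nat C)

end Telescoping

/-! ### Values of time-varying models from Bellman relations -/

section Values

variable {S A : Type*} [Fintype S] [Fintype A] [MeasurableSpace S] [MeasurableSpace A]
  [MeasurableSingletonClass S] [MeasurableSingletonClass A]

lemma le_discountedValue {r : S → A → ℝ} (hr : ∀ s a, r s a ∈ Set.Icc (0 : ℝ) 1) {γ : ℝ}
    (hγ : γ ∈ Set.Ico (0 : ℝ) 1) {π : Policy S A} {κ : ℕ → TransitionKernel S A} {V : S → ℝ}
    (hV : ∀ t s, V s ≤ bellman r γ π (κ t) V s) (s : S) : V s ≤ discountedValue r γ π κ s := by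
  obtain ⟨C, hC⟩ := exists_abs_le V
  rw [← stateExpectation_zero π κ s V]
  refine le_of_hasSum_of_le_add_mul hγ (abs_stateExpectation_le π κ s hC) (fun t => ?_)
    (hasSum_discountedValue hr hγ π κ s)
  simpa using add_stateExpectation_le r (c := 0) (fun s => by simpa using hV t s) s

lemma discountedValue_eq {r : S → A → ℝ} (hr : ∀ s a, r s a ∈ Set.Icc (0 : ℝ) 1) {γ : ℝ}
    (hγ : γ ∈ Set.Ico (0 : ℝ) 1) {π : Policy S A} {κ : ℕ → TransitionKernel S A} {V : S → ℝ}
    (hV : ∀ t s, V s = bellman r γ π (κ t) V s) (s : S) : discountedValue r γ π κ s = V s := by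
  refine le_antisymm ?_ (le_discountedValue hr hγ (fun t s => (hV t s).le) s)
  obtain ⟨C, hC⟩ := exists_abs_le V
  -- The upper bound is the telescoping lower bound applied to the negated rewards and values.
  rw [← stateExpectation_zero π κ s V, ← neg_le_neg_iff]
  refine le_of_hasSum_of_le_add_mul (ρ := fun t => -expectedReward r π κ s t)
    (η := fun t => -stateExpectation π κ s V t) (C := C) hγ
    (fun t => by rw [abs_neg]; exact abs_stateExpectation_le π κ s hC t) (fun t => ?_) ?_
  · have := add_stateExpectation_eq r (c := 0) (fun s => by simpa using hV t s) s
    linarith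
  · simpa only [mul_neg] using (hasSum_discountedValue hr hγ π κ s).neg

/-- A Bellman inequality bounds the finite-horizon averages from below; passing from the discount
factor `γ` to `1` costs `(1 - γ) C`. -/
lemma le_finiteAverage {r : S → A → ℝ} {γ : ℝ} (hγ : γ ≤ 1) {π : Policy S A}
    {κ : ℕ → TransitionKernel S A} {c C : ℝ} {h : S → ℝ} (hC : ∀ s, |h s| ≤ C)
    (H : ∀ t s, c + h s ≤ bellman r γ π (κ t) h s) (s : S) {n : ℕ} (hn : 0 < n) :
    c - (1 - γ) * C - 2 * C / n ≤ finiteAverage r π κ s n := by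
  rw [finiteAverage_eq]
  have hη := abs_stateExpectation_le π κ s hC
  refine sub_div_le_average hη (fun t => ?_) hn
  have := add_stateExpectation_le r (H t) s
  nlinarith [mul_le_mul_of_nonneg_left (abs_le.1 (hη (t + 1))).1 (sub_nonneg.2 hγ)]

lemma finiteAverage_le {r : S → A → ℝ} {γ : ℝ} (hγ : γ ≤ 1) {π : Policy S A}
    {κ : ℕ → TransitionKernel S A} {c C : ℝ} {h : S → ℝ} (hC : ∀ s, |h s| ≤ C)
    (H : ∀ t s, c + h s = bellman r γ π (κ t) h s) (s : S) {n : ℕ} (hn : 0 < n) :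
    finiteAverage r π κ s n ≤ c + (1 - γ) * C + 2 * C / n := by
  rw [finiteAverage_eq]
  have hη := abs_stateExpectation_le π κ s hC
  refine average_le_add_div hη (fun t => ?_) hn
  have := add_stateExpectation_eq r (H t) s
  nlinarith [mul_le_mul_of_nonneg_left (abs_le.1 (hη (t + 1))).2 (sub_nonneg.2 hγ)]

end Values

/-! ### Harmonic functions of unichain matrices -/

section Harmonic

variable {S : Type*}

/-- Accessible sets shrink along paths. A state reachable from `s` whose accessible set has least
cardinality keeps the same set after any further move, so it can be reached back. -/
lemma exists_accessible_recurrent [Finite S] (Q : Matrix S S ℝ) (s : S) :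
    ∃ s', Accessible Q s s' ∧ IsRecurrentState Q s' := by
  obtain ⟨s', hs', hmin⟩ := Set.exists_min_image {u | Accessible Q s u}
    (fun u => {v | Accessible Q u v}.ncard) (Set.toFinite _) ⟨s, Relation.ReflTransGen.refl⟩
  refine ⟨s', hs', fun u hu => ?_⟩
  have hsub : {v | Accessible Q u v} ⊆ {v | Accessible Q s' v} := fun v hv => hu.trans hv
  have heq := Set.eq_of_subset_of_ncard_le hsub (hmin u (hs'.trans hu)) (Set.toFinite _)
  have hmem : s' ∈ {v | Accessible Q s' v} := Relation.ReflTransGen.refl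
  rwa [← heq] at hmem

variable [Fintype S]

/-- Maximum principle: where the maximum is attained it is an average of values no larger, so each
successor of positive probability attains it too. -/
lemma eq_of_accessible_of_harmonic {Q : Matrix S S ℝ} (hQ : ∀ s s', 0 ≤ Q s s')
    (hQ1 : ∀ s, ∑ s', Q s s' = 1) {h : S → ℝ} (hh : ∀ s, h s = ∑ s', Q s s' * h s') {s s' : S}
    (hs : ∀ u, h u ≤ h s) (hacc : Accessible Q s s') : h s' = h s := by
  induction hacc with
  | refl => rfl
  | @tail u v _ huv ih =>
    have hsum : ∑ w, Q u w * (h s - h w) = 0 := by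
      simp only [mul_sub, Finset.sum_sub_distrib]
      rw [← Finset.sum_mul, hQ1, ← hh, ih]
      ring
    have := (Finset.sum_eq_zero_iff_of_nonneg
      fun w _ => mul_nonneg (hQ u w) (sub_nonneg.2 (hs w))).1 hsum v (Finset.mem_univ v)
    rcases mul_eq_zero.1 this with h0 | h0
    · exact absurd h0 huv.ne'
    · linarith

lemma harmonic_eq_of_isUnichain {Q : Matrix S S ℝ} (hQ : ∀ s s', 0 ≤ Q s s')
    (hQ1 : ∀ s, ∑ s', Q s s' = 1) (huni : IsUnichain Q) {h : S → ℝ}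
    (hh : ∀ s, h s = ∑ s', Q s s' * h s') (s s' : S) : h s = h s' := by
  have : Nonempty S := ⟨s⟩
  obtain ⟨u, hu⟩ := Finite.exists_max h
  obtain ⟨v, hv⟩ := Finite.exists_min h
  obtain ⟨u', huu', hu'⟩ := exists_accessible_recurrent Q u
  obtain ⟨v', hvv', hv'⟩ := exists_accessible_recurrent Q v
  -- The recurrent state `v'` carries both extremes: the maximum travels from `u` through `u'` to
  -- `v'`, the minimum from `v` to `v'`.
  have h1 : h v' = h u := eq_of_accessible_of_harmonic hQ hQ1 hh hu (huu'.trans (huni u' v' hu' hv'))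
  have h2 : -h v' = -h v := eq_of_accessible_of_harmonic (h := fun s => -h s) hQ hQ1
    (fun s => by simp only [mul_neg, Finset.sum_neg_distrib]; rw [← hh])
    (fun w => neg_le_neg (hv w)) hvv'
  linarith [hu s, hu s', hv s, hv s']

end Harmonic

/-! ### Uniform bounds on the oscillation of value functions -/

lemma isCompact_rectSet {S A : Type*} [Fintype S] {U : S → A → Set (stdSimplex ℝ S)}
    (hcompact : ∀ s a, IsCompact (U s a)) : IsCompact (rectSet U) := by
  have : rectSet U = Set.univ.pi fun s => Set.univ.pi fun a => U s a := by
    ext P; simp [rectSet]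
  rw [this]
  exact isCompact_univ_pi fun s => isCompact_univ_pi fun a => hcompact s a

section UniformBound

variable {S A : Type*} [Fintype S] [Fintype A]

lemma stepMean_eq_sum (π : Policy S A) (P : TransitionKernel S A) (h : S → ℝ) (s : S) :
    stepMean π P h s = ∑ s', inducedMatrix π P s s' * h s' := by
  simp only [stepMean, mean, inducedMatrix, Matrix.of_apply, Finset.sum_mul, Finset.mul_sum]
  rw [Finset.sum_comm]
  exact Finset.sum_congr rfl fun _ _ => Finset.sum_congr rfl fun _ _ => by ring

lemma eq_of_stepMean_eq {π : Policy S A} {P : TransitionKernel S A}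
    (huni : IsUnichain (inducedMatrix π P)) {h : S → ℝ} (hh : ∀ s, h s = stepMean π P h s)
    (s s' : S) : h s = h s' := by
  refine harmonic_eq_of_isUnichain (fun s s' => ?_) (fun s => ?_) huni
    (fun s => (hh s).trans (stepMean_eq_sum π P h s)) s s'
  · exact Finset.sum_nonneg fun a _ =>
      mul_nonneg (stdSimplex.zero_le _ _) (stdSimplex.zero_le _ _)
  · have := stepMean_eq_sum π P (fun _ => 1) s
    simpa [stepMean, mean_const] using this.symm

/-- A quantitative, uniform version of the fact that harmonic functions are constant. -/
lemma exists_pos_le_sum_abs_sub {U : S → A → Set (stdSimplex ℝ S)}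
    (hcompact : ∀ s a, IsCompact (U s a))
    (hunichain : ∀ P ∈ rectSet U, ∀ π : Policy S A, IsUnichain (inducedMatrix π P)) :
    ∃ δ > 0, ∀ γ ∈ Set.Icc (0 : ℝ) 1, ∀ π : Policy S A, ∀ P ∈ rectSet U, ∀ h : S → ℝ,
      (∀ s, h s ∈ Set.Icc (0 : ℝ) 1) → (∃ s, h s = 0) → (∃ s, h s = 1) →
      δ ≤ ∑ s, |h s - γ * stepMean π P h s| := by
  let H : Set (S → ℝ) := (Set.Icc 0 1 ∩ ⋃ s, {h | h s = 0}) ∩ ⋃ s, {h | h s = 1}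
  have hH : IsCompact H := by
    refine (isCompact_Icc.inter_right ?_).inter_right ?_ <;>
    exact isClosed_iUnion_of_finite fun s => isClosed_eq (continuous_apply s) continuous_const
  let K : Set (ℝ × Policy S A × TransitionKernel S A × (S → ℝ)) :=
    Set.Icc 0 1 ×ˢ Set.univ ×ˢ rectSet U ×ˢ H
  have hK : IsCompact K :=
    isCompact_Icc.prod (isCompact_univ.prod ((isCompact_rectSet hcompact).prod hH))
  have hcont : Continuous fun z : ℝ × Policy S A × TransitionKernel S A × (S → ℝ) =>
      ∑ s, |z.2.2.2 s - z.1 * stepMean z.2.1 z.2.2.1 z.2.2.2 s| := by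
    refine continuous_finsetSum _ fun s _ => (Continuous.sub ?_ ?_).abs
    · exact (continuous_apply s).comp
        (continuous_snd.comp (continuous_snd.comp continuous_snd))
    · exact continuous_fst.mul ((continuous_stepMean s).comp continuous_snd)
  -- On the compact set `K` the continuous defect needs only pointwise positivity. Zero defect at a
  -- point where `h = 1` forces `γ = 1`; then `h` is harmonic, hence constant, yet it takes both
  -- values 0 and 1.
  obtain ⟨δ, hδ, hle⟩ := hK.exists_forall_le' (a := 0) hcont.continuousOn (by
    rintro ⟨γ, π, P, h⟩ ⟨hγ, -, hP, ⟨hIcc, h0⟩, h1⟩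
    obtain ⟨s₀, hs₀⟩ := Set.mem_iUnion.1 h0
    obtain ⟨s₁, hs₁⟩ := Set.mem_iUnion.1 h1
    simp only [Set.mem_ofPred_eq] at hγ hP hs₀ hs₁ ⊢
    refine (Finset.sum_nonneg fun s _ => abs_nonneg _).lt_of_ne fun hzero => ?_
    have heq : ∀ s, h s = γ * stepMean π P h s := fun s => by
      have := (Finset.sum_eq_zero_iff_of_nonneg fun s _ => abs_nonneg _).1 hzero.symm s
        (Finset.mem_univ s)
      exact sub_eq_zero.1 (abs_eq_zero.1 this)
    have hγ1 : γ = 1 := by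
      have hle := stepMean_le π P (c := 1) (fun s => hIcc.2 s) s₁
      have := heq s₁
      rw [hs₁] at this
      nlinarith [hγ.1, hγ.2]
    have := eq_of_stepMean_eq (hunichain P hP π) (fun s => by simpa [hγ1] using heq s) s₀ s₁
    rw [hs₀, hs₁] at this
    exact zero_ne_one this)
  refine ⟨δ, hδ, fun γ hγ π P hP h hIcc h0 h1 => hle (γ, π, P, h) ⟨hγ, trivial, hP, ⟨⟨?_, ?_⟩, ?_⟩⟩⟩
  · exact ⟨fun s => (hIcc s).1, fun s => (hIcc s).2⟩
  · exact Set.mem_iUnion.2 h0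
  · exact Set.mem_iUnion.2 h1

/-- The Bellman equation at a maximiser and at a minimiser of `V` bounds the extremes. -/
lemma one_sub_mul_mem_Icc {r : S → A → ℝ} (hr : ∀ s a, r s a ∈ Set.Icc (0 : ℝ) 1) {γ : ℝ}
    (hγ : γ ∈ Set.Ico (0 : ℝ) 1) {π : Policy S A} {P : TransitionKernel S A} {V : S → ℝ}
    (hV : ∀ s, V s = bellman r γ π P V s) (s : S) : (1 - γ) * V s ∈ Set.Icc (0 : ℝ) 1 := by
  have : Nonempty S := ⟨s⟩
  obtain ⟨u, hu⟩ := Finite.exists_max V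
  obtain ⟨v, hv⟩ := Finite.exists_min V
  have h1 := hV u
  have h2 := hV v
  rw [bellman_eq] at h1 h2
  have h3 : mean (π u) (r u) ≤ 1 := mean_le _ fun a => (hr u a).2
  have h4 : 0 ≤ mean (π v) (r v) := le_mean _ fun a => (hr v a).1
  have h5 := mul_le_mul_of_nonneg_left (stepMean_le π P hu u) hγ.1
  have h6 := mul_le_mul_of_nonneg_left (le_stepMean π P hv v) hγ.1
  have h7 : 0 ≤ 1 - γ := sub_nonneg.2 hγ.2.le
  have h8 := mul_le_mul_of_nonneg_left (hu s) h7
  have h9 := mul_le_mul_of_nonneg_left (hv s) h7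
  constructor <;> linarith

/-- The oscillation of the discounted value functions of stationary models is bounded uniformly in
the discount factor, the policy and the model. -/
lemma exists_oscillation_bound {r : S → A → ℝ} (hr : ∀ s a, r s a ∈ Set.Icc (0 : ℝ) 1)
    {U : S → A → Set (stdSimplex ℝ S)} (hcompact : ∀ s a, IsCompact (U s a))
    (hunichain : ∀ P ∈ rectSet U, ∀ π : Policy S A, IsUnichain (inducedMatrix π P)) :
    ∃ C, ∀ γ ∈ Set.Ico (0 : ℝ) 1, ∀ π : Policy S A, ∀ P ∈ rectSet U, ∀ V : S → ℝ,
      (∀ s, V s = bellman r γ π P V s) → ∀ s s', |V s - V s'| ≤ C := by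
  obtain ⟨δ, hδ, H⟩ := exists_pos_le_sum_abs_sub hcompact hunichain
  refine ⟨Fintype.card S / δ, fun γ hγ π P hP V hV s s' => ?_⟩
  have : Nonempty S := ⟨s⟩
  obtain ⟨u, hu⟩ := Finite.exists_max V
  obtain ⟨v, hv⟩ := Finite.exists_min V
  suffices hL : V u - V v ≤ Fintype.card S / δ by
    rw [abs_le]
    constructor <;> linarith [hu s, hu s', hv s, hv s']
  rcases (sub_nonneg.2 (hu v)).eq_or_lt with hL | hL
  · rw [← hL]; positivity
  have key := H γ ⟨hγ.1, hγ.2.le⟩ π P hP (fun w => (V u - V v)⁻¹ * (V w - V v))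
    (fun w => ⟨mul_nonneg (inv_nonneg.2 hL.le) (sub_nonneg.2 (hv w)),
      by rw [inv_mul_le_one₀ hL]; linarith [hu w]⟩)
    ⟨v, by simp⟩ ⟨u, inv_mul_cancel₀ hL.ne'⟩
  -- For the rescaled function the defect is a difference of two numbers in `[0, 1]` divided by the
  -- oscillation. Summed over states it is at least `δ`, so the oscillation cannot exceed `card S /
  -- δ`.
  have hterm : ∀ w, |(V u - V v)⁻¹ * (V w - V v) -
      γ * stepMean π P (fun w => (V u - V v)⁻¹ * (V w - V v)) w| ≤ (V u - V v)⁻¹ := fun w => by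
    have h1 : (V u - V v)⁻¹ * (V w - V v) -
        γ * stepMean π P (fun w => (V u - V v)⁻¹ * (V w - V v)) w =
        (V u - V v)⁻¹ * (mean (π w) (r w) - (1 - γ) * V v) := by
      have h2 := hV w
      rw [bellman_eq] at h2
      rw [stepMean_const_mul, stepMean_sub_const]
      linear_combination (V u - V v)⁻¹ * h2
    have h3 := one_sub_mul_mem_Icc hr hγ hV v
    have h4 : mean (π w) (r w) ≤ 1 := mean_le _ fun a => (hr w a).2
    have h5 : 0 ≤ mean (π w) (r w) := le_mean _ fun a => (hr w a).1
    rw [h1, abs_mul, abs_of_pos (inv_pos.2 hL)]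
    refine mul_le_of_le_one_right (inv_nonneg.2 hL.le) (abs_le.2 ⟨?_, ?_⟩) <;>
      linarith [h3.1, h3.2]
  have hsum := key.trans (Finset.sum_le_sum fun w _ => hterm w)
  rw [Finset.sum_const, Finset.card_univ, nsmul_eq_mul, ← div_eq_mul_inv, le_div_iff₀ hL] at hsum
  rw [le_div_iff₀ hδ]
  linarith

end UniformBound

/-! ### Optimality equations -/

section Optimality

variable {S A : Type*} [Fintype S] [Fintype A]

/-- The worst mean of `h` over a set of probability vectors. -/
def worstMean (u : Set (stdSimplex ℝ S)) (h : S → ℝ) : ℝ := sInf ((fun p => mean p h) '' u)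

lemma isLeast_worstMean {u : Set (stdSimplex ℝ S)} (hu : IsCompact u) (hne : u.Nonempty)
    (h : S → ℝ) : IsLeast ((fun p => mean p h) '' u) (worstMean u h) :=
  (hu.image (continuous_mean.comp (Continuous.prodMk_left h))).isLeast_sInf (hne.image _)

/-- Test `h` against the minimiser for `k`. -/
lemma worstMean_sub_le {u : Set (stdSimplex ℝ S)} (hu : IsCompact u) (hne : u.Nonempty)
    (h k : S → ℝ) : worstMean u h - worstMean u k ≤ dist h k := by
  obtain ⟨p, hp, hpk⟩ := (isLeast_worstMean hu hne k).1
  have h1 : worstMean u h ≤ mean p h := (isLeast_worstMean hu hne h).2 ⟨p, hp, rfl⟩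
  have h2 : mean p (fun s => h s - k s) ≤ dist h k := mean_le p fun s =>
    (le_abs_self _).trans (dist_le_pi_dist h k s)
  rw [mean_sub] at h2
  simp only at hpk
  linarith

lemma exists_discounted_optimality (r : S → A → ℝ) {U : S → A → Set (stdSimplex ℝ S)}
    (hne : ∀ s a, (U s a).Nonempty) (hcompact : ∀ s a, IsCompact (U s a)) {γ : ℝ}
    (hγ : γ ∈ Set.Ico (0 : ℝ) 1) (π : Policy S A) :
    ∃ V : S → ℝ, ∃ P ∈ rectSet U, (∀ s, V s = bellman r γ π P V s) ∧
      ∀ s a, ∀ p ∈ U s a, mean (P s a) V ≤ mean p V := by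
  let T : (S → ℝ) → S → ℝ := fun V s => mean (π s) fun a => r s a + γ * worstMean (U s a) V
  have hT : ContractingWith ⟨γ, hγ.1⟩ T := by
    refine ⟨hγ.2, LipschitzWith.of_dist_le_mul fun V W => ?_⟩
    refine (dist_pi_le_iff (mul_nonneg hγ.1 dist_nonneg)).2 fun s => ?_
    rw [Real.dist_eq, ← mean_sub]
    refine abs_mean_le _ fun a => ?_
    rw [add_sub_add_left_eq_sub, ← mul_sub, abs_mul, abs_of_nonneg hγ.1]
    refine mul_le_mul_of_nonneg_left (abs_le.2 ⟨?_, ?_⟩) hγ.1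
    · have := worstMean_sub_le (hcompact s a) (hne s a) W V
      rw [dist_comm] at this
      linarith
    · exact worstMean_sub_le (hcompact s a) (hne s a) V W
  have hfix : T hT.fixedPoint = hT.fixedPoint := hT.fixedPoint_isFixedPt
  choose P hP hPV using fun s a => (isLeast_worstMean (hcompact s a) (hne s a) hT.fixedPoint).1
  refine ⟨hT.fixedPoint, P, hP, fun s => ?_, fun s a p hp => ?_⟩
  · simp only at hPV
    conv_lhs => rw [← hfix]
    simp only [T, bellman, hPV]
  · exact (hPV s a).trans_le
      ((isLeast_worstMean (hcompact s a) (hne s a) _).2 ⟨p, hp, rfl⟩)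

/-- The relative value function `V - V s₀` solves a normalized optimality equation. -/
lemma relative_optimality {r : S → A → ℝ} {U : S → A → Set (stdSimplex ℝ S)} {γ : ℝ}
    {π : Policy S A} {V : S → ℝ} {P : TransitionKernel S A}
    (hV : ∀ s, V s = bellman r γ π P V s)
    (hmin : ∀ s a, ∀ p ∈ U s a, mean (P s a) V ≤ mean p V) (s₀ : S) :
    (∀ s, (1 - γ) * V s₀ + (V s - V s₀) = bellman r γ π P (fun s => V s - V s₀) s) ∧
      ∀ s a, ∀ p ∈ U s a,
        mean (P s a) (fun s => V s - V s₀) ≤ mean p (fun s => V s - V s₀) := by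
  constructor
  · intro s
    have := hV s
    rw [bellman_eq] at this ⊢
    rw [stepMean_sub_const]
    linarith
  · intro s a p hp
    simp only [mean_sub, mean_const]
    linarith [hmin s a p hp]

/-- Vanishing discount without subsequences: the normalised solutions, with `γ` as a coordinate,
form a compact set. Its projection to `γ` is closed and contains `[0, 1)`, hence contains 1. -/
lemma exists_average_optimality [Nonempty S] {r : S → A → ℝ}
    (hr : ∀ s a, r s a ∈ Set.Icc (0 : ℝ) 1) {U : S → A → Set (stdSimplex ℝ S)}
    (hne : ∀ s a, (U s a).Nonempty) (hcompact : ∀ s a, IsCompact (U s a))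
    (hunichain : ∀ P ∈ rectSet U, ∀ π : Policy S A, IsUnichain (inducedMatrix π P))
    (π : Policy S A) :
    ∃ (c : ℝ) (h : S → ℝ), ∃ P ∈ rectSet U, (∀ s, c + h s = bellman r 1 π P h s) ∧
      ∀ s a, ∀ p ∈ U s a, mean (P s a) h ≤ mean p h := by
  obtain ⟨C, hC⟩ := exists_oscillation_bound hr hcompact hunichain
  obtain ⟨s₀⟩ := ‹Nonempty S›
  let B : Set (ℝ × ℝ × TransitionKernel S A × (S → ℝ)) :=
    Set.Icc 0 1 ×ˢ Set.Icc 0 1 ×ˢ rectSet U ×ˢ Set.Icc (fun _ => -C) (fun _ => C)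
  have hB : IsCompact B :=
    isCompact_Icc.prod (isCompact_Icc.prod ((isCompact_rectSet hcompact).prod isCompact_Icc))
  let E : Set (ℝ × ℝ × TransitionKernel S A × (S → ℝ)) :=
    (⋂ s, {z | z.2.1 + z.2.2.2 s = bellman r z.1 π z.2.2.1 z.2.2.2 s}) ∩
      ⋂ s, ⋂ a, ⋂ p ∈ U s a, {z | mean (z.2.2.1 s a) z.2.2.2 ≤ mean p z.2.2.2}
  have hh : Continuous fun z : ℝ × ℝ × TransitionKernel S A × (S → ℝ) => z.2.2.2 :=
    continuous_snd.comp (continuous_snd.comp continuous_snd)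
  have hP : Continuous fun z : ℝ × ℝ × TransitionKernel S A × (S → ℝ) => z.2.2.1 :=
    continuous_fst.comp (continuous_snd.comp continuous_snd)
  have hE : IsClosed E := by
    refine IsClosed.inter (isClosed_iInter fun s => ?_) (isClosed_iInter fun s =>
      isClosed_iInter fun a => isClosed_iInter fun p => isClosed_iInter fun hp => ?_)
    · simp only [bellman_eq]
      refine isClosed_eq ?_ ?_
      · exact (continuous_fst.comp continuous_snd).add ((continuous_apply s).comp hh)
      · refine continuous_const.add (continuous_fst.mul ?_)
        exact (continuous_stepMean s).comp (continuous_const.prodMk (hP.prodMk hh))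
    · refine isClosed_le ?_ ?_
      · exact continuous_mean.comp
          (((continuous_apply a).comp ((continuous_apply s).comp hP)).prodMk hh)
      · exact continuous_mean.comp (continuous_const.prodMk hh)
  have hproj : IsClosed (Prod.fst '' (B ∩ E)) :=
    ((hB.inter_right hE).image continuous_fst).isClosed
  have hsub : Set.Ico (0 : ℝ) 1 ⊆ Prod.fst '' (B ∩ E) := by
    intro γ hγ
    obtain ⟨V, P, hP, hV, hmin⟩ := exists_discounted_optimality r hne hcompact hγ π
    obtain ⟨h1, h2⟩ := relative_optimality hV hmin s₀
    refine ⟨(γ, (1 - γ) * V s₀, P, fun s => V s - V s₀), ⟨⟨⟨hγ.1, hγ.2.le⟩,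
      one_sub_mul_mem_Icc hr hγ hV s₀, hP, ?_⟩, ?_, ?_⟩, rfl⟩
    · exact ⟨fun s => (abs_le.1 (hC γ hγ π P hP V hV s s₀)).1,
        fun s => (abs_le.1 (hC γ hγ π P hP V hV s s₀)).2⟩
    · exact Set.mem_iInter.2 h1
    · simp only [Set.mem_iInter]
      exact h2
  have h1 : (1 : ℝ) ∈ Prod.fst '' (B ∩ E) := by
    refine closure_minimal hsub hproj ?_
    rw [closure_Ico zero_ne_one]
    exact ⟨zero_le_one, le_rfl⟩
  obtain ⟨⟨γ, c, P, h⟩, ⟨⟨-, -, hPU, -⟩, hz⟩, hγ⟩ := h1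
  simp only at hγ
  subst hγ
  simp only [E, Set.mem_inter_iff, Set.mem_iInter, Set.mem_ofPred_eq] at hz
  exact ⟨c, h, P, hPU, hz.1, hz.2⟩

end Optimality

/-! ### Robust values -/

section Robust

variable {S A : Type*} [Fintype S] [Fintype A] [MeasurableSpace S] [MeasurableSpace A]
  [MeasurableSingletonClass S] [MeasurableSingletonClass A]

lemma isLeast_discountedValue {r : S → A → ℝ} (hr : ∀ s a, r s a ∈ Set.Icc (0 : ℝ) 1)
    {U : S → A → Set (stdSimplex ℝ S)} {γ : ℝ} (hγ : γ ∈ Set.Ico (0 : ℝ) 1) {π : Policy S A}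
    {V : S → ℝ} {P : TransitionKernel S A} (hP : P ∈ rectSet U)
    (hV : ∀ s, V s = bellman r γ π P V s)
    (hmin : ∀ s a, ∀ p ∈ U s a, mean (P s a) V ≤ mean p V) (s : S) :
    IsLeast ((fun κ => discountedValue r γ π κ s) '' kernelSeqs U) (V s) := by
  refine ⟨⟨fun _ => P, fun _ => hP, discountedValue_eq hr hγ (fun _ => hV) s⟩, ?_⟩
  rintro _ ⟨κ, hκ, rfl⟩
  exact le_discountedValue hr hγ (fun t s => (hV s).trans_le
    (bellman_mono hγ.1 π (fun s a => hmin s a _ (hκ t s a)) s)) s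

/-- Used twice: with `γ = 1`, where the error vanishes, for optimality of the average, and with `γ <
1` to compare it with the discounted value. -/
lemma le_averageReward_of_optimality {r : S → A → ℝ} (hr : ∀ s a, r s a ∈ Set.Icc (0 : ℝ) 1)
    {U : S → A → Set (stdSimplex ℝ S)} {γ : ℝ} (hγ : γ ∈ Set.Icc (0 : ℝ) 1) {π : Policy S A}
    {c C : ℝ} {h : S → ℝ} {P : TransitionKernel S A} (hC : ∀ s, |h s| ≤ C)
    (heq : ∀ s, c + h s = bellman r γ π P h s)
    (hmin : ∀ s a, ∀ p ∈ U s a, mean (P s a) h ≤ mean p h)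
    {κ : ℕ → TransitionKernel S A} (hκ : κ ∈ kernelSeqs U) (s : S) :
    c - (1 - γ) * C ≤ averageReward r π κ s := by
  refine le_averageReward hr (tendsto_add_const_div _ (-(2 * C))) ?_
  filter_upwards [eventually_gt_atTop 0] with n hn
  rw [neg_div, ← sub_eq_add_neg]
  exact le_finiteAverage hγ.2 hC (fun t s => (heq s).trans_le
    (bellman_mono hγ.1 π (fun s a => hmin s a _ (hκ t s a)) s)) s hn

lemma averageReward_const_le {r : S → A → ℝ} (hr : ∀ s a, r s a ∈ Set.Icc (0 : ℝ) 1)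
    {γ : ℝ} (hγ : γ ≤ 1) {π : Policy S A} {c C : ℝ} {h : S → ℝ} {P : TransitionKernel S A}
    (hC : ∀ s, |h s| ≤ C) (heq : ∀ s, c + h s = bellman r γ π P h s) (s : S) :
    averageReward r π (fun _ => P) s ≤ c + (1 - γ) * C := by
  refine averageReward_le hr (tendsto_add_const_div _ (2 * C)) ?_
  filter_upwards [eventually_gt_atTop 0] with n hn
  exact finiteAverage_le hγ hC (fun _ => heq) s hn

lemma isLeast_and_tendsto_of_average_optimality {r : S → A → ℝ}
    (hr : ∀ s a, r s a ∈ Set.Icc (0 : ℝ) 1) {U : S → A → Set (stdSimplex ℝ S)} {π : Policy S A}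
    {c : ℝ} {h : S → ℝ} {P : TransitionKernel S A} (hP : P ∈ rectSet U)
    (heq : ∀ s, c + h s = bellman r 1 π P h s)
    (hmin : ∀ s a, ∀ p ∈ U s a, mean (P s a) h ≤ mean p h) (s : S) :
    IsLeast ((fun κ => averageReward r π κ s) '' kernelSeqs U) c ∧
      Tendsto (finiteAverage r π (fun _ => P) s) atTop (𝓝 c) := by
  obtain ⟨C, hC⟩ := exists_abs_le h
  have htend : Tendsto (finiteAverage r π (fun _ => P) s) atTop (𝓝 c) := by
    refine tendsto_of_tendsto_of_tendsto_of_le_of_le' (tendsto_add_const_div c (-(2 * C)))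
      (tendsto_add_const_div c (2 * C)) ?_ ?_ <;>
      filter_upwards [eventually_gt_atTop 0] with n hn
    · have := le_finiteAverage le_rfl hC (κ := fun _ => P) (fun _ s => (heq s).le) s hn
      rw [neg_div]
      linarith
    · have := finiteAverage_le le_rfl hC (κ := fun _ => P) (fun _ => heq) s hn
      linarith
  refine ⟨⟨⟨fun _ => P, fun _ => hP, htend.liminf_eq⟩, ?_⟩, htend⟩
  rintro _ ⟨κ, hκ, rfl⟩
  simpa using le_averageReward_of_optimality hr ⟨zero_le_one, le_rfl⟩ hC heq hmin hκ s

end Robust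

end RobustMDP

end

/-! ### Attainment and the uniform vanishing-discount limit -/

theorem theorem2 {S A : Type*} [Fintype S] [Fintype A]
    [MeasurableSpace S] [MeasurableSpace A]
    [MeasurableSingletonClass S] [MeasurableSingletonClass A]
    (r : S → A → ℝ) (hr : ∀ s a, r s a ∈ Set.Icc (0 : ℝ) 1)
    (U : S → A → Set (stdSimplex ℝ S))
    (hne : ∀ s a, (U s a).Nonempty)
    (hcompact : ∀ s a, IsCompact (U s a))
    (hunichain : ∀ P ∈ RobustMDP.rectSet U, ∀ π : RobustMDP.Policy S A,
      RobustMDP.IsUnichain (RobustMDP.inducedMatrix π P)) :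
    -- the minimum defining the robust discounted value is attained
    (∀ γ ∈ Set.Ico (0 : ℝ) 1, ∀ (π : RobustMDP.Policy S A) (s : S),
      IsLeast ((fun κ => RobustMDP.discountedValue r γ π κ s) '' RobustMDP.kernelSeqs U)
        (RobustMDP.robustDiscountedValue r U γ π s)) ∧
    -- the minimum defining the robust average reward is attained
    (∀ (π : RobustMDP.Policy S A) (s : S),
      IsLeast ((fun κ => RobustMDP.averageReward r π κ s) '' RobustMDP.kernelSeqs U)
        (RobustMDP.robustAverageReward r U π s)) ∧
    -- and it is attained at a model whose average reward is a genuine limit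
    (∀ (π : RobustMDP.Policy S A) (s : S), ∃ κ ∈ RobustMDP.kernelSeqs U,
      Tendsto (RobustMDP.finiteAverage r π κ s) atTop
        (𝓝 (RobustMDP.robustAverageReward r U π s))) ∧
    -- uniform convergence over stationary policies (and initial states) as `γ ↑ 1`
    TendstoUniformly
      (fun (γ : ℝ) (x : RobustMDP.Policy S A × S) =>
        (1 - γ) * RobustMDP.robustDiscountedValue r U γ x.1 x.2)
      (fun x => RobustMDP.robustAverageReward r U x.1 x.2)
      (𝓝[<] (1 : ℝ)) := by
  have havg : ∀ (π : RobustMDP.Policy S A) (s : S),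
      IsLeast ((fun κ => RobustMDP.averageReward r π κ s) '' RobustMDP.kernelSeqs U)
        (RobustMDP.robustAverageReward r U π s) ∧
      ∃ κ ∈ RobustMDP.kernelSeqs U, Tendsto (RobustMDP.finiteAverage r π κ s) atTop
        (𝓝 (RobustMDP.robustAverageReward r U π s)) := by
    intro π s
    have : Nonempty S := ⟨s⟩
    obtain ⟨c, h, P, hP, heq, hmin⟩ :=
      RobustMDP.exists_average_optimality hr hne hcompact hunichain π
    obtain ⟨hleast, htend⟩ :=
      RobustMDP.isLeast_and_tendsto_of_average_optimality hr hP heq hmin s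
    have hc : RobustMDP.robustAverageReward r U π s = c := hleast.csInf_eq
    rw [hc]
    exact ⟨hleast, fun _ => P, fun _ => hP, htend⟩
  refine ⟨fun γ hγ π s => ?_, fun π s => (havg π s).1, fun π s => (havg π s).2, ?_⟩
  · obtain ⟨V, P, hP, hV, hmin⟩ := RobustMDP.exists_discounted_optimality r hne hcompact hγ π
    have hleast := RobustMDP.isLeast_discountedValue hr hγ hP hV hmin s
    have hc : RobustMDP.robustDiscountedValue r U γ π s = V s := hleast.csInf_eq
    rwa [hc]
  · obtain ⟨C, hC⟩ := RobustMDP.exists_oscillation_bound hr hcompact hunichain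
    rw [Metric.tendstoUniformly_iff]
    intro ε hε
    have hlim : Tendsto (fun γ : ℝ => (1 - γ) * C) (𝓝[<] 1) (𝓝 0) := by
      have : Tendsto (fun γ : ℝ => (1 - γ) * C) (𝓝 1) (𝓝 ((1 - 1) * C)) :=
        (tendsto_const_nhds.sub tendsto_id).mul_const C
      rw [sub_self, zero_mul] at this
      exact this.mono_left nhdsWithin_le_nhds
    filter_upwards [hlim.eventually_lt_const hε, Ioo_mem_nhdsLT zero_lt_one] with γ hγε hγ'
    rintro ⟨π, s⟩
    have hγ : γ ∈ Set.Ico (0 : ℝ) 1 := ⟨hγ'.1.le, hγ'.2⟩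
    obtain ⟨V, P, hP, hV, hmin⟩ := RobustMDP.exists_discounted_optimality r hne hcompact hγ π
    have hc : RobustMDP.robustDiscountedValue r U γ π s = V s :=
      (RobustMDP.isLeast_discountedValue hr hγ hP hV hmin s).csInf_eq
    -- Normalising at the initial state `s` itself makes the constant in the optimality equation
    -- exactly `(1 - γ) * V s`.
    obtain ⟨h1, h2⟩ := RobustMDP.relative_optimality hV hmin s
    have hosc : ∀ s', |V s' - V s| ≤ C := fun s' => hC γ hγ π P hP V hV s' s
    -- The lower estimate is evaluated at a model minimising the average reward, the upper one at
    -- the constant model `P` that is optimal for the discount factor `γ`.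
    obtain ⟨κ, hκ, hκg⟩ := (havg π s).1.1
    have hlow := RobustMDP.le_averageReward_of_optimality hr ⟨hγ.1, hγ.2.le⟩ hosc h1 h2 hκ s
    have hupp := ((havg π s).1.2 ⟨fun _ => P, fun _ => hP, rfl⟩).trans
      (RobustMDP.averageReward_const_le hr hγ.2.le hosc h1 s)
    simp only at hκg
    rw [hκg] at hlow
    simp only [hc, Real.dist_eq]
    exact (abs_le.2 ⟨by linarith, by linarith⟩ :
      |RobustMDP.robustAverageReward r U π s - (1 - γ) * V s| ≤ (1 - γ) * C).trans_lt hγε
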